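/- Conventions. Let $n\ge 1$. A cube is a set $Q=\{a\}+(-\delta,\delta]^n\subset\mathbb{R}^n$ ($a\in\mathbb{R}^n$, $\delta>0$); its sidelength is $\delta_Q=2\delta$, and for $A>0$, $AQ$ is the cube with the same center and sidelength $A\delta_Q$. A cube is dyadic if it has the form $\prod_{i=1}^n (j_i2^k,(j_i+1)2^k]$ with $j_1,\dots,j_n,k\in\mathbb{Z}$. Let $c_G>0$. There are constants $C>0$ and $0<c<1$, depending only on $n$ and $c_G$ (so only on $n$, if $c_G$ is a fixed constant determined by $n$), such that the following holds. Let $CZ$ be a partition of $\mathbb{R}^n$ into dyadic cubes such that for all $Q,Q'\in CZ$, $$(1+10c_G)Q\cap(1+10c_G)Q'\ne\emptyset \implies \tfrac1{64}\delta_Q\le\delta_{Q'}\le 64\,\delta_Q ,$$ and let $E\subset\mathbb{R}^n$ be a finite set with $N=\#(E)\ge 2$ and $\#(E\cap 9Q)\ge 2$ for every $Q\in CZ$. Call $Q\in CZ$ a keystone cube if $\delta_{Q'}\ge\delta_Q$ for every $Q'\in CZ$ with $Q'\cap 100Q\neq\emptyset$. Then there are a subset $CZ_{\rm special}\subset CZ$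 and an assignment to each $Q\in CZ$ of a finite sequence $\mathcal S_Q=(Q_1,\dots,Q_L)$ of cubes of $CZ$ (with $L\ge1$ depending on $Q$) such that: (i) $CZ_{\rm special}$ contains at most $C\cdot N$ distinct cubes. (ii) For each $Q\in CZ$: $Q_1=Q$; $Q_L$ is a keystone cube; $(1+c_G)Q_l\cap(1+c_G)Q_{l+1}\ne\emptyset$ for $1\le l<L$; and $\delta_{Q_k}\le C(1-c)^{k-l}\delta_{Q_l}$ for $1\le l\le k\le L$. (iii) If $Q,Q'\in CZ\setminus CZ_{\rm special}$ satisfy $(1+c_G)Q\cap(1+c_G)Q'\neq\emptyset$, and $\mathcal S_Q=(Q_1,\dots,Q_L)$, $\mathcal S_{Q'}=(Q'_1,\dots,Q'_{L'})$, then $Q_L=Q'_{L'}$. -/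

import Mathlib

/-- A cube `{a} + (-δ, δ]ⁿ` in `ℝⁿ`, with center `a` and half-side `δ > 0`. -/
structure AxisCube (n : ℕ) where
  center : Fin n → ℝ
  halfSide : ℝ
  halfSide_pos : 0 < halfSide

namespace AxisCube

variable {n : ℕ}

/-- The sidelength `δ_Q`. -/
noncomputable def side (Q : AxisCube n) : ℝ := 2 * Q.halfSide

/-- The set of points of the cube `A Q` (same center as `Q`, sidelength `A * δ_Q`), for `A > 0`. -/
def dilate (A : ℝ) (Q : AxisCube n) : Set (Fin n → ℝ) :=
  Set.pi Set.univ fun i => Set.Ioc (Q.center i - A * Q.halfSide) (Q.center i + A * Q.halfSide)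

/-- The set of points of the cube `Q`. -/
def toSet (Q : AxisCube n) : Set (Fin n → ℝ) :=
  Set.pi Set.univ fun i => Set.Ioc (Q.center i - Q.halfSide) (Q.center i + Q.halfSide)

/-- `Q` is a product of intervals `(j_i 2^k, (j_i + 1) 2^k]` with `j_i, k ∈ ℤ`. -/
def IsDyadic (Q : AxisCube n) : Prop :=
  ∃ (k : ℤ) (j : Fin n → ℤ), Q.toSet =
    Set.pi Set.univ fun i => Set.Ioc ((j i : ℝ) * (2 : ℝ) ^ k) (((j i : ℝ) + 1) * (2 : ℝ) ^ k)

end AxisCube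

/-- A CZ decomposition of `ℝⁿ`: a partition of `ℝⁿ` into dyadic cubes that has good geometry
with constant `cG`. -/
structure IsCZDecomposition {n : ℕ} (cG : ℝ) (CZ : Set (AxisCube n)) : Prop where
  dyadic : ∀ Q ∈ CZ, Q.IsDyadic
  cover : ⋃ Q ∈ CZ, Q.toSet = Set.univ
  disjoint : CZ.PairwiseDisjoint AxisCube.toSet
  goodGeometry : ∀ Q ∈ CZ, ∀ Q' ∈ CZ,
    (Q.dilate (1 + 10 * cG) ∩ Q'.dilate (1 + 10 * cG)).Nonempty →
      (1 / 64 : ℝ) * Q.side ≤ Q'.side ∧ Q'.side ≤ 64 * Q.side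

/-- `Q ∈ CZ` is keystone if every cube of `CZ` that meets `100 Q` is at least as large as `Q`. -/
def IsKeystone {n : ℕ} (CZ : Set (AxisCube n)) (Q : AxisCube n) : Prop :=
  Q ∈ CZ ∧ ∀ Q' ∈ CZ, (Q'.toSet ∩ Q.dilate 100).Nonempty → Q.side ≤ Q'.side

/-! Let δ(x) be the side of the cube of `CZ` containing x. Good geometry makes δ almost constant on
balls of radius comparable to δ, so points closer than (cG/2)·δ lie in touching cubes, and a
sequence of cubes may be replaced by a walk of points. Each walk carries a potential that shrinks by
θ at every step and stays comparable to δ; walks concatenate when their states match, and the decay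
estimate costs b/a once, however many pieces are joined.

Every point reaches a keystone cube: if q(x) is not keystone, a smaller cube meets 100 q(x), and
walking towards it halves δ at the first drop, by dyadicity (`exists_chain_halving`). Sides are
bounded below, so this stops.

The special cubes are those that are not tight. Such a cube sees a point of E, or a pair of points
of E, at its own scale, and can be charged to one point of E with bounded multiplicity
(`Finset.exists_net_radius`).

A tight cube sees E as nearly a single point p. In an annulus around p, δ is comparable to the
distance to p, so one can walk inwards and then around to a point depending only on the cluster
(`exists_chain_annulus`). In dimension one the annulus is disconnected, so the side of p is recorded
as well. Touching tight cubes share cluster and side, hence this target, and continue along the same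
walk to the same keystone cube. -/

open Relation

/-! ### Chains and slowly varying scales -/

/-- A step between states `(point, potential)`: the point moves by less than `cG / 2` times the
local scale, the potential decays by `θ`, and stays comparable to the scale. -/
def ChainStep {V : Type*} [PseudoMetricSpace V] (δ : V → ℝ) (cG θ a b : ℝ) (s t : V × ℝ) : Prop :=
  dist s.1 t.1 < cG / 2 * δ s.1 ∧ t.2 ≤ θ * s.2 ∧ a * δ t.1 ≤ t.2 ∧ t.2 ≤ b * δ t.1

/-- A positive function that is almost constant on balls of radius comparable to its value. -/
structure SlowlyVarying {V : Type*} [PseudoMetricSpace V] (cG : ℝ) (δ : V → ℝ) : Prop where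
  pos : ∀ x, 0 < δ x
  near : ∀ x y, dist x y < 5 * cG * δ x → δ x ≤ 64 * δ y ∧ δ y ≤ 64 * δ x

theorem Relation.ReflTransGen.exists_seq {α : Type*} {r : α → α → Prop} {s t : α}
    (h : ReflTransGen r s t) :
    ∃ (m : ℕ) (f : ℕ → α), f 0 = s ∧ f m = t ∧ ∀ i < m, r (f i) (f (i + 1)) := by
  induction h using ReflTransGen.head_induction_on with
  | refl => exact ⟨0, fun _ => t, rfl, rfl, by simp⟩
  | @head u v huv _ ih =>
    obtain ⟨m, f, h0, hm, hf⟩ := ih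
    refine ⟨m + 1, fun i => Nat.casesOn i u f, rfl, hm, ?_⟩
    rintro (_ | i) hi
    · simpa [h0] using huv
    · exact hf i (by omega)

/-- Either x lies in the ball around y where δ is almost constant, or the radius of that ball, a
multiple of δ y, is at most the distance. -/
theorem SlowlyVarying.le_add {V : Type*} [PseudoMetricSpace V] {cG : ℝ} {δ : V → ℝ}
    (hcG : 0 < cG) (h : SlowlyVarying cG δ) (x y : V) :
    δ y ≤ 64 * δ x + dist x y / (5 * cG) := by
  have hx := h.pos x
  by_cases hd : dist y x < 5 * cG * δ y
  · have := (h.near y x hd).1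
    have : 0 ≤ dist x y / (5 * cG) := by positivity
    linarith
  · rw [not_lt, dist_comm] at hd
    have : δ y ≤ dist x y / (5 * cG) := by
      rw [le_div_iff₀ (by positivity)]; linarith
    linarith

/-- Along a chain the scale decays geometrically. -/
theorem ChainStep.decay {V : Type*} [PseudoMetricSpace V] {δ : V → ℝ} {cG θ a b : ℝ}
    (ha : 0 < a) (hθ : 0 ≤ θ) {m : ℕ} {f : ℕ → V × ℝ}
    (hf : ∀ i < m, ChainStep δ cG θ a b (f i) (f (i + 1)))
    (h0 : a * δ (f 0).1 ≤ (f 0).2 ∧ (f 0).2 ≤ b * δ (f 0).1)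
    {l k : ℕ} (hlk : l ≤ k) (hk : k ≤ m) :
    δ (f k).1 ≤ b / a * θ ^ (k - l) * δ (f l).1 := by
  have hgood : ∀ i ≤ m, a * δ (f i).1 ≤ (f i).2 ∧ (f i).2 ≤ b * δ (f i).1 := by
    rintro (_ | i) hi
    · exact h0
    · exact (hf i hi).2.2
  have hpot : ∀ j, l + j ≤ m → (f (l + j)).2 ≤ θ ^ j * (f l).2 := by
    intro j
    induction j with
    | zero => intro _; simp
    | succ j ih =>
      intro hj
      calc (f (l + j + 1)).2 ≤ θ * (f (l + j)).2 := (hf (l + j) (by omega)).2.1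
        _ ≤ θ * (θ ^ j * (f l).2) := by gcongr; exact ih (by omega)
        _ = θ ^ (j + 1) * (f l).2 := by ring
  obtain ⟨j, rfl⟩ := Nat.exists_eq_add_of_le hlk
  rw [Nat.add_sub_cancel_left]
  have h1 := (hgood _ hk).1
  have h2 := hpot j hk
  have h3 : θ ^ j * (f l).2 ≤ θ ^ j * (b * δ (f l).1) := by
    gcongr; exact (hgood l (by omega)).2
  have : b / a * θ ^ j * δ (f l).1 = (θ ^ j * (b * δ (f l).1)) / a := by ring
  rw [this, le_div_iff₀ ha]
  linarith

/-! ### Chains along segments and rays -/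

section Segment

variable {V : Type*} [NormedAddCommGroup V] [NormedSpace ℝ V]

/-- Walking along a segment in equal steps. -/
theorem chain_lineMap {δ : V → ℝ} {cG θ a b φ : ℝ} {x y : V} {M : ℕ} (k : ℕ)
    (hstep : ∀ j < k, dist x y / M < cG / 2 * δ (AffineMap.lineMap x y ((j : ℝ) / M)))
    (hlow : ∀ j, 1 ≤ j → j ≤ k → a * δ (AffineMap.lineMap x y ((j : ℝ) / M)) ≤ θ ^ j * φ)
    (hup : ∀ j, 1 ≤ j → j ≤ k → θ ^ j * φ ≤ b * δ (AffineMap.lineMap x y ((j : ℝ) / M))) :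
    ReflTransGen (ChainStep δ cG θ a b) (x, φ)
      (AffineMap.lineMap x y ((k : ℝ) / M), θ ^ k * φ) := by
  induction k with
  | zero => simpa using ReflTransGen.refl
  | succ k ih =>
    refine (ih (fun j hj => hstep j (by omega)) (fun j h1 h2 => hlow j h1 (by omega))
      (fun j h1 h2 => hup j h1 (by omega))).tail ⟨?_, ?_, ?_, ?_⟩
    · have : dist (AffineMap.lineMap x y ((k : ℝ) / M) : V)
          (AffineMap.lineMap x y (((k + 1 : ℕ) : ℝ) / M)) = dist x y / M := by
        rw [dist_lineMap_lineMap, Real.dist_eq]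
        have : (k : ℝ) / M - ((k + 1 : ℕ) : ℝ) / M = - (1 / M) := by push_cast; ring
        rw [this, abs_neg, abs_of_nonneg (by positivity)]
        ring
      simp only [this]
      exact hstep k (by omega)
    · simp only; rw [pow_succ]; exact le_of_eq (by ring)
    · exact hlow (k + 1) (by omega) le_rfl
    · exact hup (k + 1) (by omega) le_rfl

/-- If there is a point at distance at most `51 δ(x)` where the scale is less than half that at
`x`, then some such point is reached from `x` by a chain. -/
theorem exists_chain_halving {δ : V → ℝ} {cG θ b D : ℝ} {M : ℕ} (hcG : 0 < cG)
    (hδ : SlowlyVarying cG δ) (hM : 102 / cG < M) (hθ1 : θ ≤ 1) (hθ0 : 0 < θ)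
    (hθM : 1 / 2 ≤ θ ^ M) (hD : 64 + 51 / cG ≤ D) (hb : 1 ≤ b)
    (hhalf : ∀ x y, δ y < δ x → δ y ≤ δ x / 2)
    {x y : V} (hxy : dist x y ≤ 51 * δ x) (hlt : δ y < δ x) :
    ∃ z, δ z ≤ δ x / 2 ∧
      ReflTransGen (ChainStep δ cG θ (1 / (2 * D)) b) (x, δ x) (z, δ z) := by
  classical
  have hx := hδ.pos x
  have hM0 : (0 : ℝ) < M := lt_trans (by positivity) hM
  have hD0 : 64 < D := lt_of_lt_of_le (by have : 0 < 51 / cG := by positivity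
                                          linarith) hD
  set z : ℕ → V := fun j => AffineMap.lineMap x y ((j : ℝ) / M) with hz
  -- Stop at the first grid point where the scale drops. Before it the scale is at least δ x, so
  -- steps of length 51 δ x / M are short enough.
  have hex : ∃ j, δ (z j) < δ x := ⟨M, by simpa [hz, div_self hM0.ne'] using hlt⟩
  have hi := Nat.find_spec hex
  have hmin : ∀ j < Nat.find hex, δ x ≤ δ (z j) := fun j hj => not_lt.1 (Nat.find_min hex hj)
  have hiM : Nat.find hex ≤ M := Nat.find_min' hex (by simpa [hz, div_self hM0.ne'] using hlt)
  have hi0 : Nat.find hex ≠ 0 := by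
    intro h; rw [h] at hi; simp [hz] at hi
  obtain ⟨i, hi'⟩ := Nat.exists_eq_succ_of_ne_zero hi0
  rw [hi'] at hi hmin hiM
  have hst : dist x y / M < cG / 2 * δ x := by
    rw [div_lt_iff₀ hM0]
    rw [div_lt_iff₀ hcG] at hM
    nlinarith
  have hpow : ∀ j, j ≤ M → 1 / 2 ≤ θ ^ j := fun j hj =>
    hθM.trans (pow_le_pow_of_le_one hθ0.le hθ1 hj)
  have hupper : ∀ j, j ≤ M → δ (z j) ≤ D * δ x := by
    intro j hj
    have h1 := hδ.le_add hcG x (z j)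
    have h2 : dist x (z j) ≤ 51 * δ x := by
      rw [hz]; simp only [dist_left_lineMap]
      have : ‖(j : ℝ) / M‖ ≤ 1 := by
        rw [Real.norm_of_nonneg (by positivity), div_le_one hM0]; exact_mod_cast hj
      calc _ ≤ 1 * dist x y := by gcongr
        _ ≤ _ := by linarith
    have h3 : dist x (z j) / (5 * cG) ≤ 51 / cG * δ x := by
      rw [div_mul_eq_mul_div, div_le_div_iff₀ (by positivity) hcG]
      nlinarith [mul_pos hcG hx, mul_le_mul_of_nonneg_right h2 hcG.le]
    nlinarith
  have hchain := chain_lineMap (δ := δ) (cG := cG) (θ := θ) (a := 1 / (2 * D)) (b := b)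
    (φ := δ x) (x := x) (y := y) (M := M) i
    (fun j hj => hst.trans_le (by gcongr; exact hmin j (by omega)))
    (fun j _ hj => by
      have h1 := hupper j (by omega)
      have h2 := hpow j (by omega)
      rw [one_div, inv_mul_le_iff₀ (by linarith)]
      calc δ (z j) ≤ D * δ x := h1
        _ = 2 * D * (1 / 2 * δ x) := by ring
        _ ≤ _ := by gcongr)
    (fun j _ hj => by
      have h1 := hmin j (by omega)
      have h2 : θ ^ j ≤ 1 := pow_le_one₀ hθ0.le hθ1
      calc θ ^ j * δ x ≤ 1 * δ x := by gcongr
        _ ≤ b * δ (z j) := by gcongr)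
  -- The last step resets the potential to the scale; this is a decay because δ z ≤ δ x / 2 ≤ θ ^ (i
  -- + 1) * δ x.
  refine ⟨z (i + 1), hhalf _ _ hi, hchain.tail ⟨?_, ?_, ?_, ?_⟩⟩
  · have : dist (AffineMap.lineMap x y ((i : ℝ) / M) : V) (z (i + 1)) = dist x y / M := by
      rw [hz]; simp only
      rw [dist_lineMap_lineMap, Real.dist_eq]
      have : (i : ℝ) / M - ((i + 1 : ℕ) : ℝ) / M = - (1 / M) := by push_cast; ring
      rw [this, abs_neg, abs_of_nonneg (by positivity)]
      ring
    simp only [this]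
    exact hst.trans_le (by gcongr; exact hmin i (by omega))
  · have h1 := hpow (i + 1) hiM
    have h2 := hhalf _ _ hi
    simp only
    calc δ (z (i + 1)) ≤ 1 / 2 * δ x := by linarith
      _ ≤ θ ^ (i + 1) * δ x := by gcongr
      _ = θ * (θ ^ i * δ x) := by ring
  · simp only
    have := hδ.pos (z (i + 1))
    calc 1 / (2 * D) * δ (z (i + 1)) ≤ 1 * δ (z (i + 1)) := by
          gcongr; rw [div_le_one (by linarith)]; linarith
      _ = _ := one_mul _
  · simp only
    have := hδ.pos (z (i + 1))
    nlinarith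

/-- Moving radially towards `p` in an annulus where the scale is comparable to the distance
to `p`. -/
theorem exists_chain_radial {δ : V → ℝ} {cG θ a b D ρ R : ℝ} {p u : V}
    (hcG : 0 < cG) (hθ1 : θ < 1) (hθ : 1 / 2 ≤ θ) (hθG : 1 - θ ≤ cG / 24)
    (hD : 64 < D) (ha : 0 ≤ a) (ha1 : a ≤ 1) (hb : 48 * D ≤ b) (hρ : 0 < ρ)
    (hann : ∀ w, ρ ≤ ‖w‖ → ‖w‖ ≤ R → ‖w‖ / 6 ≤ δ (p + w) ∧ δ (p + w) ≤ D * ‖w‖)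
    (hu : ρ ≤ ‖u‖) (huR : ‖u‖ ≤ R) :
    ∃ t : ℝ, 0 < t ∧ ρ ≤ ‖t • u‖ ∧ ‖t • u‖ ≤ 2 * ρ ∧
      ReflTransGen (ChainStep δ cG θ a b) (p + u, 8 * D * ‖u‖)
        (p + t • u, 8 * D * ‖t • u‖) := by
  have hθ0 : 0 < θ := by linarith
  have hu0 : 0 < ‖u‖ := by linarith
  -- k is the last exponent with θ ^ k * ‖u‖ ≥ ρ; since θ ≥ 1/2 the walk then ends within radius 2ρ.
  obtain ⟨k, hk1, hk2⟩ := exists_nat_pow_near_of_lt_one (x := ρ / ‖u‖) (y := θ) (by positivity)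
    (by rw [div_le_one hu0]; exact hu) hθ0 hθ1
  rw [lt_div_iff₀ hu0] at hk1
  rw [div_le_iff₀ hu0] at hk2
  have hnorm : ∀ j : ℕ, ‖θ ^ j • u‖ = θ ^ j * ‖u‖ := fun j => by
    rw [norm_smul, Real.norm_of_nonneg (by positivity)]
  refine ⟨θ ^ k, by positivity, by rw [hnorm]; exact hk2, ?_, ?_⟩
  · rw [hnorm]
    rw [pow_succ] at hk1
    have : 0 < θ ^ k * ‖u‖ := by positivity
    nlinarith
  · have key : ∀ j ≤ k, ReflTransGen (ChainStep δ cG θ a b) (p + u, 8 * D * ‖u‖)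
        (p + θ ^ j • u, 8 * D * ‖θ ^ j • u‖) := by
      intro j
      induction j with
      | zero => intro _; simpa using ReflTransGen.refl
      | succ j ih =>
        intro hj
        have hmem : ∀ i ≤ k, ρ ≤ ‖θ ^ i • u‖ ∧ ‖θ ^ i • u‖ ≤ R := by
          intro i hi
          rw [hnorm]
          constructor
          · refine hk2.trans ?_
            gcongr ?_ * _
            exact pow_le_pow_of_le_one hθ0.le hθ1.le hi
          · refine le_trans ?_ huR
            have : θ ^ i ≤ 1 := pow_le_one₀ hθ0.le hθ1.le
            nlinarith
        obtain ⟨hj1, hj2⟩ := hmem j (by omega)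
        obtain ⟨hs1, hs2⟩ := hmem (j + 1) hj
        obtain ⟨hd1, hd2⟩ := hann _ hj1 hj2
        obtain ⟨he1, he2⟩ := hann _ hs1 hs2
        refine (ih (by omega)).tail ⟨?_, ?_, ?_, ?_⟩
        · simp only [dist_add_left]
          have : dist (θ ^ j • u) (θ ^ (j + 1) • u) = (1 - θ) * ‖θ ^ j • u‖ := by
            rw [dist_eq_norm, ← sub_smul, norm_smul, hnorm]
            have : θ ^ j - θ ^ (j + 1) = (1 - θ) * θ ^ j := by ring
            rw [this, Real.norm_of_nonneg (mul_nonneg (by linarith) (by positivity))]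
            ring
          rw [this]
          -- 1 - θ ≤ cG/24 is below cG/2 · 1/6, and δ is at least a sixth of the norm.
          have hpos : 0 < ‖θ ^ j • u‖ := by linarith
          nlinarith [mul_pos hcG hpos]
        · simp only
          rw [hnorm, hnorm, pow_succ]
          exact le_of_eq (by ring)
        · simp only
          have hpos : 0 < ‖θ ^ (j + 1) • u‖ := by linarith
          have h0 : 0 < δ (p + θ ^ (j + 1) • u) := by linarith
          nlinarith
        · simp only
          have hpos : 0 < ‖θ ^ (j + 1) • u‖ := by linarith
          have h0 : 0 < δ (p + θ ^ (j + 1) • u) := by linarith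
          calc 8 * D * ‖θ ^ (j + 1) • u‖ ≤ 48 * D * δ (p + θ ^ (j + 1) • u) := by nlinarith
            _ ≤ _ := by gcongr
    exact key k le_rfl

end Segment

/-! ### Chains around an annulus -/

section Annulus

variable {n : ℕ} {δ : (Fin n → ℝ) → ℝ} {cG θ a b D ρ R : ℝ} {M : ℕ} {p : Fin n → ℝ}

/-- Moving along a segment near the inner boundary of an annulus where the scale is comparable
to the distance to `p`; the segment avoids the inner ball because one coordinate stays large. -/
theorem exists_chain_segment {u v : Fin n → ℝ} {φ : ℝ}
    (hcG : 0 < cG) (hM : 102 / cG < M) (hθ1 : θ ≤ 1) (hθ0 : 0 < θ) (hθM : 1 / 2 ≤ θ ^ M)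
    (hD : 64 < D) (ha : 0 ≤ a) (ha1 : a ≤ 1) (hb : 96 * D ≤ b) (hρ : 0 < ρ) (hρR : 2 * ρ ≤ R)
    (hann : ∀ w, ρ ≤ ‖w‖ → ‖w‖ ≤ R → ‖w‖ / 6 ≤ δ (p + w) ∧ δ (p + w) ≤ D * ‖w‖)
    (hu : ‖u‖ ≤ 2 * ρ) (hv : ‖v‖ ≤ 2 * ρ) (i : Fin n)
    (hi : (ρ ≤ u i ∧ ρ ≤ v i) ∨ (u i ≤ -ρ ∧ v i ≤ -ρ))
    (hφ1 : 4 * D * ρ ≤ φ) (hφ2 : φ ≤ 16 * D * ρ) :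
    ReflTransGen (ChainStep δ cG θ a b) (p + u, φ) (p + v, θ ^ M * φ) := by
  have hM0 : (0 : ℝ) < M := lt_trans (by positivity) hM
  have hφ0 : 0 < φ := lt_of_lt_of_le (by positivity) hφ1
  have hline : ∀ t : ℝ, 0 ≤ t → t ≤ 1 →
      ρ / 6 ≤ δ (AffineMap.lineMap (p + u) (p + v) t) ∧
        δ (AffineMap.lineMap (p + u) (p + v) t) ≤ 2 * D * ρ := by
    intro t ht0 ht1
    set w : Fin n → ℝ := AffineMap.lineMap u v t with hw
    have hpw : AffineMap.lineMap (p + u) (p + v) t = p + w := by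
      rw [hw]; ext j; simp [AffineMap.lineMap_apply]; ring
    have hwn : ‖w‖ ≤ 2 * ρ := by
      have : w = (1 - t) • u + t • v := by rw [hw, AffineMap.lineMap_apply_module]
      rw [this]
      calc ‖(1 - t) • u + t • v‖ ≤ ‖(1 - t) • u‖ + ‖t • v‖ := norm_add_le _ _
        _ = (1 - t) * ‖u‖ + t * ‖v‖ := by
            rw [norm_smul, norm_smul, Real.norm_of_nonneg ht0,
              Real.norm_of_nonneg (sub_nonneg.2 ht1)]
        _ ≤ 2 * ρ := by nlinarith
    have hwi : w i = (1 - t) * u i + t * v i := by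
      rw [hw, AffineMap.lineMap_apply_module]; simp
    have hwl : ρ ≤ ‖w‖ := by
      refine le_trans ?_ (norm_le_pi_norm w i)
      rw [Real.norm_eq_abs, hwi]
      rcases hi with ⟨h1, h2⟩ | ⟨h1, h2⟩
      · exact le_trans (by nlinarith) (le_abs_self _)
      · exact le_trans (by nlinarith) (neg_le_abs _)
    obtain ⟨h1, h2⟩ := hann w hwl (hwn.trans hρR)
    rw [hpw]
    constructor
    · linarith
    · nlinarith
  have hdist : dist (p + u) (p + v) ≤ 4 * ρ := by
    rw [dist_add_left, dist_eq_norm]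
    linarith [norm_sub_le u v]
  have hpow : ∀ j, j ≤ M → 1 / 2 ≤ θ ^ j := fun j hj =>
    hθM.trans (pow_le_pow_of_le_one hθ0.le hθ1 hj)
  have hfrac : ∀ j : ℕ, j ≤ M → (0 : ℝ) ≤ (j : ℝ) / M ∧ (j : ℝ) / M ≤ 1 := fun j hj =>
    ⟨by positivity, by rw [div_le_one hM0]; exact_mod_cast hj⟩
  -- On the segment δ lies in [ρ/6, 2Dρ]. Half of φ is still at least 2Dρ, and 16Dρ = 96D · ρ/6
  -- explains the bound on b.
  have h := chain_lineMap (δ := δ) (cG := cG) (θ := θ) (a := a) (b := b) (φ := φ)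
    (x := p + u) (y := p + v) (M := M) M
    (fun j hj => by
      have h1 := (hline _ (hfrac j hj.le).1 (hfrac j hj.le).2).1
      refine lt_of_lt_of_le ?_ (mul_le_mul_of_nonneg_left h1 (by positivity))
      rw [div_lt_iff₀ hM0]
      rw [div_lt_iff₀ hcG] at hM
      nlinarith)
    (fun j _ hj => by
      have h1 := (hline _ (hfrac j hj).1 (hfrac j hj).2)
      have h2 := hpow j hj
      calc a * δ (AffineMap.lineMap (p + u) (p + v) ((j : ℝ) / M))
          ≤ 1 * (2 * D * ρ) := by
            gcongr
            · linarith [h1.1]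
            · exact h1.2
        _ ≤ 1 / 2 * φ := by linarith
        _ ≤ θ ^ j * φ := by gcongr)
    (fun j _ hj => by
      have h1 := (hline _ (hfrac j hj).1 (hfrac j hj).2)
      have h2 : θ ^ j ≤ 1 := pow_le_one₀ hθ0.le hθ1
      calc θ ^ j * φ ≤ 1 * (16 * D * ρ) := by gcongr
        _ = 96 * D * (ρ / 6) := by ring
        _ ≤ b * δ (AffineMap.lineMap (p + u) (p + v) ((j : ℝ) / M)) := by
            gcongr
            · linarith
            · exact h1.1)
  simpa [div_self hM0.ne'] using h

/-- From any point of an annulus where the scale is comparable to the distance to `p`, a chain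
leads to the point `p + σ ρ (1, …, 1)`; in dimension one the sign `σ` has to fit. -/
theorem exists_chain_annulus {u : Fin n → ℝ} {σ : ℝ} (hn : 1 ≤ n)
    (hcG : 0 < cG) (hM : 102 / cG < M) (hθ1 : θ < 1) (hθ : 1 / 2 ≤ θ)
    (hθG : 1 - θ ≤ cG / 24) (hθM : 1 / 2 ≤ θ ^ M)
    (hD : 64 < D) (ha : 0 ≤ a) (ha1 : a ≤ 1) (hb : 96 * D ≤ b) (hρ : 0 < ρ) (hρR : 2 * ρ ≤ R)
    (hann : ∀ w, ρ ≤ ‖w‖ → ‖w‖ ≤ R → ‖w‖ / 6 ≤ δ (p + w) ∧ δ (p + w) ≤ D * ‖w‖)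
    (hu : ρ ≤ ‖u‖) (huR : ‖u‖ ≤ R) (hσ : σ = 1 ∨ σ = -1) (hσu : 2 ≤ n ∨ ∀ i, 0 < σ * u i) :
    ReflTransGen (ChainStep δ cG θ a b) (p + u, 8 * D * ‖u‖)
      (p + fun _ => σ * ρ, δ (p + fun _ => σ * ρ)) := by
  have hθ0 : 0 < θ := by linarith
  obtain ⟨t, ht0, ht1, ht2, hrad⟩ := exists_chain_radial hcG hθ1 hθ hθG hD ha ha1
    (by linarith) hρ hann hu huR (b := b)
  refine hrad.trans ?_
  set v := t • u with hv
  have : Nonempty (Fin n) := ⟨⟨0, hn⟩⟩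
  have hnorm : ‖(fun _ => σ * ρ : Fin n → ℝ)‖ = ρ := by
    rw [pi_norm_const, norm_mul, Real.norm_of_nonneg hρ.le]
    rcases hσ with rfl | rfl <;> simp
  have hx0 := hann (fun _ => σ * ρ) hnorm.ge (by rw [hnorm]; linarith)
  rw [hnorm] at hx0
  -- A final stationary step lowers the potential to the scale itself, so that a keystone chain can
  -- be appended.
  suffices h : ∃ φ, 2 * D * ρ ≤ φ ∧ ReflTransGen (ChainStep δ cG θ a b) (p + v, 8 * D * ‖v‖)
      (p + fun _ => σ * ρ, φ) by
    obtain ⟨φ, hφ, hch⟩ := h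
    refine hch.tail ⟨?_, ?_, ?_, ?_⟩
    · have : 0 < δ (p + fun _ => σ * ρ) := by linarith
      simp only [dist_self]; positivity
    · simp only; nlinarith
    · simp only; nlinarith
    · simp only; nlinarith
  obtain ⟨i, hi⟩ : ∃ i, ρ ≤ ‖v i‖ := by
    by_contra! hcon
    exact absurd ht1 (not_le.2 ((pi_norm_lt_iff hρ).2 hcon))
  have hφ1 : 8 * D * ρ ≤ 8 * D * ‖v‖ := by gcongr
  have hφ2 : 8 * D * ‖v‖ ≤ 16 * D * ρ := by nlinarith
  rw [Real.norm_eq_abs, le_abs'] at hi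
  have hφ3 : 4 * D * ρ ≤ θ ^ M * (8 * D * ‖v‖) := by
    calc 4 * D * ρ = 1 / 2 * (8 * D * ρ) := by ring
      _ ≤ θ ^ M * (8 * D * ‖v‖) := by gcongr
  have hDρ : 0 < D * ρ := by nlinarith
  rcases hσu with h2 | hs
  · obtain ⟨k, hk⟩ : ∃ k : Fin n, k ≠ i := by
      have : Nontrivial (Fin n) := Fin.nontrivial_iff_two_le.2 h2
      exact exists_ne i
    -- Two segments: from v to w coordinate i keeps the path outside the inner ball, from w to the
    -- target coordinate k does.
    set w := Function.update v k (σ * ρ) with hw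
    have hwi : w i = v i := Function.update_of_ne hk.symm _ _
    have hwk : w k = σ * ρ := Function.update_self _ _ _
    have hwn : ‖w‖ ≤ 2 * ρ := by
      rw [pi_norm_le_iff_of_nonneg (by linarith)]
      intro j
      by_cases hj : j = k
      · rw [hj, hwk, norm_mul, Real.norm_of_nonneg hρ.le]
        rcases hσ with rfl | rfl <;> simp <;> linarith
      · rw [hw, Function.update_of_ne hj]
        exact (norm_le_pi_norm v j).trans ht2
    have c1 := exists_chain_segment hcG hM hθ1.le hθ0 hθM hD ha ha1 hb hρ hρR hann ht2 hwn i
      (by rw [hwi]; tauto) (by linarith) hφ2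
    have hφ4 : θ ^ M * (8 * D * ‖v‖) ≤ 16 * D * ρ := by
      have : θ ^ M ≤ 1 := pow_le_one₀ hθ0.le hθ1.le
      have : 0 ≤ 8 * D * ‖v‖ := by linarith
      nlinarith
    have c2 := exists_chain_segment hcG hM hθ1.le hθ0 hθM hD ha ha1 hb hρ hρR hann
      (v := fun _ => σ * ρ) hwn (by rw [hnorm]; linarith) k
      (by rw [hwk]; rcases hσ with rfl | rfl
          · left; constructor <;> linarith
          · right; constructor <;> linarith) hφ3 hφ4
    refine ⟨_, ?_, c1.trans c2⟩
    calc 2 * D * ρ = 1 / 2 * (4 * D * ρ) := by ring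
      _ ≤ _ := by gcongr
  · refine ⟨_, ?_, exists_chain_segment hcG hM hθ1.le hθ0 hθM hD ha ha1 hb hρ hρR hann
      (v := fun _ => σ * ρ) ht2 (by rw [hnorm]; linarith) i ?_ (by linarith) hφ2⟩
    · linarith
    · have h1 : 0 < σ * v i := by
        have : σ * v i = t * (σ * u i) := by rw [hv]; simp; ring
        rw [this]; exact mul_pos ht0 (hs i)
      rcases hσ with rfl | rfl
      · left
        rcases hi with hi | hi
        · linarith
        · constructor <;> linarith
      · right
        rcases hi with hi | hi
        · constructor <;> linarith
        · linarith

end Annulus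

/-! ### Nets in a finite metric space -/

/-- A finite metric space carries a function `d` all of whose superlevel sets `{d > t}` are
`t`-dense and `t`-separated (for `t < T`): insert points in farthest-first order. -/
theorem Finset.exists_net_radius {X : Type*} [PseudoMetricSpace X] (E : Finset X)
    (hE : E.Nonempty) (T : ℝ) :
    ∃ d : X → ℝ, (∀ e ∈ E, ∀ e' ∈ E, e ≠ e' → min (d e) (d e') ≤ dist e e') ∧
      ∀ t < T, 0 ≤ t → ∀ p ∈ E, ∃ e ∈ E, t < d e ∧ dist p e ≤ t := by
  classical
  -- The middle invariant says that F is a d f-net of E for each f in F. So the covering radius h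
  -- given to the next point is at most all earlier values: for t < h every point is kept, and for t
  -- ≥ h the new point is not needed.
  have key : ∀ m, 1 ≤ m → m ≤ E.card → ∃ F ⊆ E, F.card = m ∧ ∃ d : X → ℝ,
      (∀ e ∈ F, ∀ e' ∈ F, e ≠ e' → min (d e) (d e') ≤ dist e e') ∧
      (∀ f ∈ F, ∀ p ∈ E, ∃ f' ∈ F, dist p f' ≤ d f) ∧
      ∀ t < T, (∀ p ∈ E, ∃ f ∈ F, dist p f ≤ t) → ∀ p ∈ E, ∃ f ∈ F, t < d f ∧ dist p f ≤ t := by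
    intro m hm
    induction m, hm using Nat.le_induction with
    | base =>
      intro _
      obtain ⟨e₀, he₀⟩ := hE
      obtain ⟨q, -, hq⟩ := E.exists_max_image (fun x => dist x e₀) ⟨e₀, he₀⟩
      -- T keeps the first point in every superlevel set with t < T; the distance to the farthest
      -- point q makes it cover E.
      refine ⟨{e₀}, by simpa using he₀, by simp, fun _ => max T (dist q e₀), ?_, ?_, ?_⟩
      · simp
      · intro f _ p hp
        exact ⟨e₀, by simp, (hq p hp).trans (le_max_right _ _)⟩
      · intro t ht h p hp
        obtain ⟨f, hf, hpf⟩ := h p hp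
        exact ⟨f, hf, ht.trans_le (le_max_left _ _), hpf⟩
    | succ m hm ih =>
      intro hmE
      obtain ⟨F, hFE, hFm, d, hα, hγ, hβ⟩ := ih (by omega)
      have hF : F.Nonempty := Finset.card_pos.1 (by omega)
      have hEF : (E \ F).Nonempty := by
        rw [← Finset.card_pos, Finset.card_sdiff_of_subset hFE]; omega
      have hg : ∀ x, ∃ f ∈ F, ∀ f' ∈ F, dist x f ≤ dist x f' := fun x =>
        F.exists_min_image (dist x) hF
      choose g hgF hgmin using hg
      obtain ⟨e, he, hemax⟩ := (E \ F).exists_max_image (fun x => dist x (g x)) hEF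
      rw [Finset.mem_sdiff] at he
      set h := dist e (g e) with hh
      have hcov : ∀ p ∈ E, ∃ f ∈ F, dist p f ≤ h := by
        intro p hp
        by_cases hpF : p ∈ F
        · exact ⟨p, hpF, by rw [dist_self]; exact dist_nonneg⟩
        · exact ⟨g p, hgF p, hemax p (Finset.mem_sdiff.2 ⟨hp, hpF⟩)⟩
      have hdF : ∀ f ∈ F, Function.update d e h f = d f := fun f hf =>
        Function.update_of_ne (fun hfe : f = e => he.2 (hfe ▸ hf)) _ _
      have hde : Function.update d e h e = h := Function.update_self _ _ _
      have hdh : ∀ f ∈ F, h ≤ d f := by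
        intro f hf
        obtain ⟨f', hf', h1⟩ := hγ f hf e he.1
        exact (hgmin e f' hf').trans h1
      refine ⟨insert e F, Finset.insert_subset he.1 hFE, ?_, Function.update d e h, ?_, ?_, ?_⟩
      · rw [Finset.card_insert_of_notMem he.2, hFm]
      · intro x hx y hy hxy
        rw [Finset.mem_insert] at hx hy
        rcases hx with rfl | hx <;> rcases hy with rfl | hy
        · exact absurd rfl hxy
        · rw [hde]; exact (min_le_left _ _).trans (hgmin _ _ hy)
        · rw [hde, dist_comm]; exact (min_le_right _ _).trans (hgmin _ _ hx)
        · rw [hdF x hx, hdF y hy]; exact hα x hx y hy hxy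
      · intro f hf p hp
        rw [Finset.mem_insert] at hf
        rcases hf with rfl | hf
        · obtain ⟨f', hf', h1⟩ := hcov p hp
          exact ⟨f', Finset.mem_insert_of_mem hf', by rwa [hde]⟩
        · obtain ⟨f', hf', h1⟩ := hγ f hf p hp
          exact ⟨f', Finset.mem_insert_of_mem hf', by rwa [hdF f hf]⟩
      · intro t ht hcov' p hp
        by_cases hth : h ≤ t
        · obtain ⟨f, hf, h1, h2⟩ := hβ t ht (fun q hq => by
            obtain ⟨f, hf, h1⟩ := hcov q hq
            exact ⟨f, hf, h1.trans hth⟩) p hp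
          exact ⟨f, Finset.mem_insert_of_mem hf, by rwa [hdF f hf], h2⟩
        · rw [not_le] at hth
          obtain ⟨f, hf, h1⟩ := hcov' p hp
          refine ⟨f, hf, ?_, h1⟩
          rw [Finset.mem_insert] at hf
          rcases hf with rfl | hf
          · rwa [hde]
          · rw [hdF f hf]; exact hth.trans_le (hdh f hf)
  obtain ⟨F, hFE, hFm, d, hα, -, hβ⟩ := key E.card (Finset.card_pos.2 hE) le_rfl
  obtain rfl : F = E := Finset.eq_of_subset_of_card_le hFE hFm.ge
  exact ⟨d, hα, fun t ht ht0 => hβ t ht fun p hp => ⟨p, hp, by rwa [dist_self]⟩⟩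

/-! ### Geometry and counting of cubes -/

namespace AxisCube

variable {n : ℕ}

theorem side_pos (Q : AxisCube n) : 0 < Q.side := by
  have := Q.halfSide_pos
  unfold side; linarith

theorem mem_toSet_iff {Q : AxisCube n} {x : Fin n → ℝ} :
    x ∈ Q.toSet ↔ ∀ i, Q.center i - Q.halfSide < x i ∧ x i ≤ Q.center i + Q.halfSide := by
  simp [toSet]

theorem mem_dilate_iff {Q : AxisCube n} {A : ℝ} {x : Fin n → ℝ} :
    x ∈ Q.dilate A ↔
      ∀ i, Q.center i - A * Q.halfSide < x i ∧ x i ≤ Q.center i + A * Q.halfSide := by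
  simp [dilate]

theorem center_mem (Q : AxisCube n) : Q.center ∈ Q.toSet := by
  have := Q.halfSide_pos
  rw [mem_toSet_iff]
  exact fun i => ⟨by linarith, by linarith⟩

theorem toSet_subset_dilate (Q : AxisCube n) {A : ℝ} (hA : 1 ≤ A) : Q.toSet ⊆ Q.dilate A := by
  intro x hx
  rw [mem_toSet_iff] at hx
  rw [mem_dilate_iff]
  intro i
  have := Q.halfSide_pos
  obtain ⟨h1, h2⟩ := hx i
  constructor <;> nlinarith

theorem dist_center_le_of_mem_dilate {Q : AxisCube n} {A : ℝ} (hA : 0 ≤ A) {x : Fin n → ℝ}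
    (hx : x ∈ Q.dilate A) : dist x Q.center ≤ A / 2 * Q.side := by
  have := Q.halfSide_pos
  rw [mem_dilate_iff] at hx
  unfold side
  rw [dist_pi_le_iff (by positivity)]
  intro i
  obtain ⟨h1, h2⟩ := hx i
  rw [Real.dist_eq, abs_le]
  constructor <;> linarith

theorem dist_center_le_of_mem {Q : AxisCube n} {x : Fin n → ℝ} (hx : x ∈ Q.toSet) :
    dist x Q.center ≤ Q.side / 2 := by
  have := dist_center_le_of_mem_dilate zero_le_one (Q.toSet_subset_dilate le_rfl hx)
  linarith

/-- A point closer than `cG / 2 * side` to a point of `Q` lies in `(1 + cG) Q`. -/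
theorem mem_dilate_of_dist_lt {Q : AxisCube n} {c : ℝ} {x y : Fin n → ℝ} (hx : x ∈ Q.toSet)
    (hxy : dist x y < c / 2 * Q.side) : y ∈ Q.dilate (1 + c) := by
  rw [mem_toSet_iff] at hx
  rw [mem_dilate_iff]
  intro i
  obtain ⟨h1, h2⟩ := hx i
  have h3 := (dist_le_pi_dist x y i).trans_lt hxy
  unfold side at h3
  rw [Real.dist_eq, abs_lt] at h3
  constructor <;> linarith

theorem exists_side_eq_zpow (hn : 1 ≤ n) {Q : AxisCube n} (hQ : Q.IsDyadic) :
    ∃ k : ℤ, Q.side = (2 : ℝ) ^ k := by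
  obtain ⟨k, j, h⟩ := hQ
  refine ⟨k, ?_⟩
  have hne : Q.toSet.Nonempty := ⟨_, Q.center_mem⟩
  have h1 := congrArg (fun s => (fun x : Fin n → ℝ => x ⟨0, hn⟩) '' s) h
  have hne2 := h ▸ hne
  unfold toSet at h1 hne
  rw [Set.eval_image_univ_pi hne, Set.eval_image_univ_pi hne2] at h1
  have := Q.halfSide_pos
  obtain ⟨h2, h3⟩ := (Set.Ioc_eq_Ioc_iff (Or.inl (by linarith))).1 h1
  unfold side
  linarith

/-- Sides are powers of two. This turns any drop of the scale into a halving. -/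
theorem side_le_half_of_lt (hn : 1 ≤ n) {Q Q' : AxisCube n} (hQ : Q.IsDyadic)
    (hQ' : Q'.IsDyadic) (h : Q'.side < Q.side) : Q'.side ≤ Q.side / 2 := by
  obtain ⟨k, hk⟩ := exists_side_eq_zpow hn hQ
  obtain ⟨k', hk'⟩ := exists_side_eq_zpow hn hQ'
  rw [hk, hk'] at h
  rw [hk, hk']
  have h1 : k' < k := (zpow_lt_zpow_iff_right₀ (one_lt_two (α := ℝ))).1 h
  have h2 : (2 : ℝ) ^ k' ≤ 2 ^ (k - 1) := (zpow_le_zpow_iff_right₀ (one_lt_two (α := ℝ))).2 (by omega)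
  rw [zpow_sub_one₀ (by norm_num)] at h2
  linarith

/-- The index set of the cells of a grid around the origin. -/
noncomputable def gridBox (n : ℕ) (K : ℝ) : Finset (Fin n → ℤ) :=
  Fintype.piFinset fun _ => Finset.Icc (-⌈2 * K⌉) ⌈2 * K⌉

/-- Disjoint cubes of side at least `s` with centers within `K s` of a point are bounded in
number. -/
theorem finite_and_ncard_le_gridBox {S : Set (AxisCube n)} (hS : S.PairwiseDisjoint toSet)
    (e : Fin n → ℝ) {s K : ℝ} (hs : 0 < s)
    (h : ∀ Q ∈ S, s ≤ Q.side ∧ dist Q.center e ≤ K * s) :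
    S.Finite ∧ S.ncard ≤ (gridBox n K).card := by
  set f : AxisCube n → Fin n → ℤ := fun Q i => ⌊(Q.center i - e i) / (s / 2)⌋ with hf
  have hmaps : ∀ Q ∈ S, f Q ∈ (gridBox n K : Set (Fin n → ℤ)) := by
    intro Q hQ
    rw [gridBox, Finset.mem_coe, Fintype.mem_piFinset]
    intro i
    have h1 := (dist_le_pi_dist Q.center e i).trans (h Q hQ).2
    rw [Real.dist_eq, abs_le] at h1
    rw [Finset.mem_Icc]
    have h2 : (Q.center i - e i) / (s / 2) ≤ 2 * K := by
      rw [div_le_iff₀ (by positivity)]; linarith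
    have h3 : -(2 * K) ≤ (Q.center i - e i) / (s / 2) := by
      rw [le_div_iff₀ (by positivity)]; linarith
    constructor
    · rw [hf, ← Int.floor_neg]; exact Int.floor_le_floor h3
    · exact (Int.floor_le_floor h2).trans (Int.floor_le_ceil _)
  -- Centers in the same cell of width s/2 differ by less than the half-side of either cube, so one
  -- center lies in the other cube.
  have hinj : Set.InjOn f S := by
    intro Q hQ Q' hQ' heq
    refine hS.elim_set hQ hQ' Q'.center ?_ Q'.center_mem
    rw [mem_toSet_iff]
    intro i
    have h1 := Int.abs_sub_lt_one_of_floor_eq_floor (congrFun heq i)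
    rw [← sub_div, abs_div, abs_of_pos (by positivity : 0 < s / 2),
      div_lt_one (by positivity)] at h1
    have h2 := (h Q hQ).1
    unfold side at h2
    rw [abs_lt] at h1
    constructor <;> linarith
  refine ⟨Set.Finite.of_injOn hmaps hinj (Finset.finite_toSet _), ?_⟩
  rw [← Set.ncard_coe_finset]
  exact Set.ncard_le_ncard_of_injOn f hmaps hinj (Finset.finite_toSet _)

/-- Disjoint cubes of side comparable to `w` with centers within comparable distance of a point
are bounded in number. -/
theorem finite_and_ncard_le_of_comparable {CZ : Set (AxisCube n)}
    (hCZ : CZ.PairwiseDisjoint toSet) (e : Fin n → ℝ) {α β A : ℝ} (hα : 0 < α) (hβ : 0 < β)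
    (hA : 0 ≤ A) (w : ℝ) :
    {Q ∈ CZ | dist e Q.center ≤ A * Q.side ∧ α * Q.side < w ∧ w ≤ β * Q.side}.Finite ∧
      {Q ∈ CZ | dist e Q.center ≤ A * Q.side ∧ α * Q.side < w ∧ w ≤ β * Q.side}.ncard ≤
        (gridBox n (A * β / α)).card := by
  by_cases hw : 0 < w
  · refine finite_and_ncard_le_gridBox (hCZ.subset (Set.sep_subset _ _)) e
      (div_pos hw hβ) ?_
    rintro Q ⟨-, h1, h2, h3⟩
    refine ⟨by rw [div_le_iff₀ hβ]; linarith, ?_⟩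
    rw [dist_comm]
    refine h1.trans ?_
    have h4 : Q.side ≤ w / α := by rw [le_div_iff₀ hα]; linarith
    calc A * Q.side ≤ A * (w / α) := by gcongr
      _ = A * β / α * (w / β) := by field_simp
  · have : {Q ∈ CZ | dist e Q.center ≤ A * Q.side ∧ α * Q.side < w ∧ w ≤ β * Q.side} = ∅ := by
      ext Q
      simp only [Set.mem_sep_iff, Set.mem_empty_iff_false, iff_false]
      rintro ⟨-, -, h2, -⟩
      have := mul_pos hα Q.side_pos
      linarith
    rw [this]
    simp

end AxisCube

open AxisCube

/-! ### Chains to keystone cubes; tight cubes -/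

section Decomposition

variable {n : ℕ} {cG : ℝ} {CZ : Set (AxisCube n)} {q : (Fin n → ℝ) → AxisCube n}
  {E : Finset (Fin n → ℝ)}

theorem IsCZDecomposition.exists_cubeAt (hCZ : IsCZDecomposition cG CZ) :
    ∃ q : (Fin n → ℝ) → AxisCube n, ∀ x, q x ∈ CZ ∧ x ∈ (q x).toSet := by
  have : ∀ x : Fin n → ℝ, ∃ Q, Q ∈ CZ ∧ x ∈ Q.toSet := by
    intro x
    have hx : x ∈ ⋃ Q ∈ CZ, Q.toSet := by rw [hCZ.cover]; trivial
    simpa using hx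
  exact Classical.axiomOfChoice this

theorem IsCZDecomposition.cubeAt_eq (hCZ : IsCZDecomposition cG CZ)
    (hq : ∀ x, q x ∈ CZ ∧ x ∈ (q x).toSet) {Q : AxisCube n} (hQ : Q ∈ CZ) {x : Fin n → ℝ}
    (hx : x ∈ Q.toSet) : q x = Q :=
  hCZ.disjoint.elim_set (hq x).1 hQ x (hq x).2 hx

theorem IsCZDecomposition.side_comparable (hCZ : IsCZDecomposition cG CZ) {Q Q' : AxisCube n}
    (hQ : Q ∈ CZ) (hQ' : Q' ∈ CZ)
    (h : (Q.dilate (1 + 10 * cG) ∩ Q'.dilate (1 + 10 * cG)).Nonempty) :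
    Q.side ≤ 64 * Q'.side ∧ Q'.side ≤ 64 * Q.side := by
  obtain ⟨h1, h2⟩ := hCZ.goodGeometry Q hQ Q' hQ' h
  exact ⟨by linarith, h2⟩

theorem AxisCube.dilate_mono (Q : AxisCube n) {A B : ℝ} (h : A ≤ B) :
    Q.dilate A ⊆ Q.dilate B := by
  intro x hx
  rw [mem_dilate_iff] at hx ⊢
  intro i
  have := Q.halfSide_pos
  obtain ⟨h1, h2⟩ := hx i
  constructor <;> nlinarith

theorem IsCZDecomposition.slowlyVarying (hCZ : IsCZDecomposition cG CZ) (hcG : 0 < cG)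
    (hq : ∀ x, q x ∈ CZ ∧ x ∈ (q x).toSet) : SlowlyVarying cG fun x => (q x).side where
  pos x := (q x).side_pos
  near x y h := by
    refine hCZ.side_comparable (hq x).1 (hq y).1 ⟨y, ?_, ?_⟩
    · exact mem_dilate_of_dist_lt (hq x).2 (h.trans_eq (by ring))
    · exact toSet_subset_dilate _ (by linarith) (hq y).2

theorem IsCZDecomposition.exists_mem_dist_le (hq : ∀ x, q x ∈ CZ ∧ x ∈ (q x).toSet)
    (hE : ∀ Q ∈ CZ, 2 ≤ ((E : Set (Fin n → ℝ)) ∩ Q.dilate 9).ncard) (x : Fin n → ℝ) :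
    ∃ e ∈ E, dist e x ≤ 5 * (q x).side := by
  have h := hE _ (hq x).1
  obtain ⟨e, heE, he⟩ := Set.nonempty_of_ncard_ne_zero
    (s := (E : Set (Fin n → ℝ)) ∩ (q x).dilate 9) (by omega)
  refine ⟨e, heE, ?_⟩
  have h1 := dist_center_le_of_mem_dilate (by norm_num) he
  have h2 := dist_center_le_of_mem (hq x).2
  linarith [dist_triangle_right e x (q x).center]

/-- Two points of E in 9Q are at most nine sides apart, and at least the minimal distance in E. This
makes the descent to a keystone cube terminate. -/
theorem IsCZDecomposition.exists_pos_le_side (hE2 : 2 ≤ E.card)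
    (hE : ∀ Q ∈ CZ, 2 ≤ ((E : Set (Fin n → ℝ)) ∩ Q.dilate 9).ncard) :
    ∃ m : ℝ, 0 < m ∧ ∀ Q ∈ CZ, m ≤ Q.side := by
  obtain ⟨e₁, h₁, e₂, h₂, hne⟩ := Finset.one_lt_card.1 hE2
  obtain ⟨⟨p, p'⟩, hp, hmin⟩ := E.offDiag.exists_min_image (fun z => dist z.1 z.2)
    ⟨(e₁, e₂), Finset.mem_offDiag.2 ⟨h₁, h₂, hne⟩⟩
  rw [Finset.mem_offDiag] at hp
  refine ⟨dist p p' / 9, div_pos (dist_pos.2 hp.2.2) (by norm_num), fun Q hQ => ?_⟩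
  obtain ⟨x, y, ⟨hxE, hx⟩, ⟨hyE, hy⟩, hxy⟩ := (Set.one_lt_ncard_iff
    (E.finite_toSet.inter_of_left _)).1 (hE Q hQ)
  have h := hmin (x, y) (Finset.mem_offDiag.2 ⟨hxE, hyE, hxy⟩)
  have h1 := dist_center_le_of_mem_dilate (by norm_num) hx
  have h2 := dist_center_le_of_mem_dilate (by norm_num) hy
  simp only at h
  linarith [dist_triangle_right x y Q.center]

/-- Every point is joined to a point of a keystone cube by a chain. -/
theorem IsCZDecomposition.exists_chain_keystone (hCZ : IsCZDecomposition cG CZ) (hn : 1 ≤ n)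
    (hcG : 0 < cG) (hq : ∀ x, q x ∈ CZ ∧ x ∈ (q x).toSet) (hE2 : 2 ≤ E.card)
    (hE : ∀ Q ∈ CZ, 2 ≤ ((E : Set (Fin n → ℝ)) ∩ Q.dilate 9).ncard)
    {θ b D : ℝ} {M : ℕ} (hM : 102 / cG < M) (hθ1 : θ ≤ 1) (hθ0 : 0 < θ)
    (hθM : 1 / 2 ≤ θ ^ M) (hD : 64 + 51 / cG ≤ D) (hb : 1 ≤ b) (x : Fin n → ℝ) :
    ∃ y, IsKeystone CZ (q y) ∧
      ReflTransGen (ChainStep (fun x => (q x).side) cG θ (1 / (2 * D)) b)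
        (x, (q x).side) (y, (q y).side) := by
  obtain ⟨m, hm, hmle⟩ := IsCZDecomposition.exists_pos_le_side hE2 hE
  obtain ⟨k, hk⟩ : ∃ k : ℕ, (q x).side < 2 ^ k * m := by
    obtain ⟨k, hk⟩ := pow_unbounded_of_one_lt ((q x).side / m) one_lt_two
    exact ⟨k, by rwa [div_lt_iff₀ hm] at hk⟩
  induction k generalizing x with
  | zero => have := hmle _ (hq x).1; linarith
  | succ k ih =>
    by_cases hkey : IsKeystone CZ (q x)
    · exact ⟨x, hkey, ReflTransGen.refl⟩
    · have : ∃ Q' ∈ CZ, (Q'.toSet ∩ (q x).dilate 100).Nonempty ∧ Q'.side < (q x).side := by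
        by_contra! hcon
        exact hkey ⟨(hq x).1, hcon⟩
      obtain ⟨Q', hQ', ⟨y, hyQ', hy⟩, hlt⟩ := this
      rw [← hCZ.cubeAt_eq hq hQ' hyQ'] at hlt
      have h1 := dist_center_le_of_mem_dilate (by norm_num) hy
      have h2 := dist_center_le_of_mem (hq x).2
      have h3 := dist_triangle_right x y (q x).center
      have h4 : dist x y ≤ 51 * (q x).side := by linarith [(q x).side_pos]
      obtain ⟨z, hz, hch⟩ := exists_chain_halving (δ := fun x => (q x).side) hcG
        (hCZ.slowlyVarying hcG hq) hM hθ1 hθ0 hθM hD hb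
        (fun x y h => side_le_half_of_lt hn (hCZ.dyadic _ (hq x).1) (hCZ.dyadic _ (hq y).1) h)
        h4 hlt
      obtain ⟨w, hw, hch'⟩ := ih z (by rw [pow_succ] at hk; linarith)
      exact ⟨w, hw, hch.trans hch'⟩

/-- The points of `E` near `Q` form a tight cluster, near which the scale is small. -/
def IsTight (δ : (Fin n → ℝ) → ℝ) (E : Finset (Fin n → ℝ)) (A ε : ℝ) (Q : AxisCube n) : Prop :=
  ∀ p ∈ E, dist p Q.center ≤ A * Q.side →
    δ p ≤ ε * Q.side ∧ ∀ p' ∈ E, dist p' Q.center ≤ A * Q.side → dist p p' ≤ ε * Q.side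

/-- Tightness fails in two ways. If δ p is too large, it is comparable to the side, and Q is charged
to p. If p and p' are too far apart, their net points at scale ε/4 · side are distinct, so one has d
comparable to the side and is charged. Each point of E pays for boundedly many cubes. -/
theorem IsCZDecomposition.finite_and_ncard_not_isTight_le (hCZ : IsCZDecomposition cG CZ)
    (hcG : 0 < cG) (hq : ∀ x, q x ∈ CZ ∧ x ∈ (q x).toSet) (hE0 : E.Nonempty)
    {A ε : ℝ} (hA : 0 < A) (hε : 0 < ε) :
    {Q ∈ CZ | ¬ IsTight (fun x => (q x).side) E A ε Q}.Finite ∧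
      {Q ∈ CZ | ¬ IsTight (fun x => (q x).side) E A ε Q}.ncard ≤
        E.card * ((gridBox n (A * (64 + A / (5 * cG)) / ε)).card +
          (gridBox n ((A + ε) * (2 * A + ε) / (ε / 4))).card) := by
  obtain ⟨d, hd1, hd2⟩ := E.exists_net_radius hE0 (Metric.diam (E : Set (Fin n → ℝ)))
  set S₁ : (Fin n → ℝ) → Set (AxisCube n) := fun e => {Q ∈ CZ | dist e Q.center ≤ A * Q.side ∧
    ε * Q.side < (q e).side ∧ (q e).side ≤ (64 + A / (5 * cG)) * Q.side} with hS₁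
  set S₂ : (Fin n → ℝ) → Set (AxisCube n) := fun e => {Q ∈ CZ |
    dist e Q.center ≤ (A + ε) * Q.side ∧ ε / 4 * Q.side < d e ∧ d e ≤ (2 * A + ε) * Q.side}
    with hS₂
  have hS₁c := fun e => finite_and_ncard_le_of_comparable hCZ.disjoint e hε
    (by positivity : 0 < 64 + A / (5 * cG)) hA.le (q e).side
  have hS₂c := fun e => finite_and_ncard_le_of_comparable hCZ.disjoint e
    (by positivity : 0 < ε / 4) (by positivity : 0 < 2 * A + ε) (by positivity : 0 ≤ A + ε) (d e)
  have hsub : {Q ∈ CZ | ¬ IsTight (fun x => (q x).side) E A ε Q} ⊆ ⋃ e ∈ E, (S₁ e ∪ S₂ e) := by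
    rintro Q ⟨hQ, hnt⟩
    have hs := Q.side_pos
    rw [Set.mem_iUnion₂]
    unfold IsTight at hnt
    push Not at hnt
    obtain ⟨p, hp, hpQ, himp⟩ := hnt
    by_cases hδ : (q p).side ≤ ε * Q.side
    · obtain ⟨p', hp', hp'Q, hpp'⟩ := himp hδ
      have hdiam : ε / 4 * Q.side < Metric.diam (E : Set (Fin n → ℝ)) := by
        have := Metric.dist_le_diam_of_mem E.finite_toSet.isBounded (Finset.mem_coe.2 hp)
          (Finset.mem_coe.2 hp')
        nlinarith
      have ht0 : 0 ≤ ε / 4 * Q.side := by positivity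
      obtain ⟨e, he, hde, hpe⟩ := hd2 _ hdiam ht0 p hp
      obtain ⟨e', he', hde', hpe'⟩ := hd2 _ hdiam ht0 p' hp'
      have hdist : dist p p' ≤ dist p e + dist e e' + dist p' e' := by
        linarith [dist_triangle4_right p p' e e', dist_triangle p e p', dist_triangle e e' p',
          dist_comm p' e']
      have hdist2 : dist e e' ≤ (2 * A + ε) * Q.side := by
        have h1 := dist_triangle_right e e' Q.center
        have h2 := dist_triangle_left e Q.center p
        have h3 := dist_triangle_left e' Q.center p'
        nlinarith
      have hne : e ≠ e' := by
        rintro rfl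
        rw [dist_self] at hdist
        nlinarith
      rcases min_le_iff.1 (hd1 e he e' he' hne) with h | h
      · refine ⟨e, he, Or.inr ⟨hQ, ?_, hde, h.trans hdist2⟩⟩
        have := dist_triangle_left e Q.center p
        nlinarith
      · refine ⟨e', he', Or.inr ⟨hQ, ?_, hde', h.trans hdist2⟩⟩
        have := dist_triangle_left e' Q.center p'
        nlinarith
    · refine ⟨p, hp, Or.inl ⟨hQ, hpQ, not_le.1 hδ, ?_⟩⟩
      have h1 := (hCZ.slowlyVarying hcG hq).le_add hcG Q.center p
      simp only [hCZ.cubeAt_eq hq hQ Q.center_mem] at h1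
      have h2 : dist Q.center p / (5 * cG) ≤ A * Q.side / (5 * cG) := by
        rw [dist_comm]; gcongr
      calc (q p).side ≤ 64 * Q.side + A * Q.side / (5 * cG) := h1.trans (by gcongr)
        _ = _ := by ring
  have hfin : (⋃ e ∈ E, (S₁ e ∪ S₂ e)).Finite :=
    E.finite_toSet.biUnion fun e _ => (hS₁c e).1.union (hS₂c e).1
  refine ⟨hfin.subset hsub, (Set.ncard_le_ncard hsub hfin).trans ?_⟩
  refine (E.set_ncard_biUnion_le _).trans ?_
  rw [← smul_eq_mul]
  refine Finset.sum_le_card_nsmul _ _ _ fun e _ => ?_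
  exact (Set.ncard_union_le _ _).trans (add_le_add (hS₁c e).2 (hS₂c e).2)

/-- A tight cube lies in an annulus around a point of its cluster in which the scale is
comparable to the distance to that point. -/
theorem IsCZDecomposition.exists_chain_of_isTight (hCZ : IsCZDecomposition cG CZ) (hn : 1 ≤ n)
    (hcG : 0 < cG) (hq : ∀ x, q x ∈ CZ ∧ x ∈ (q x).toSet)
    (hE : ∀ Q ∈ CZ, 2 ≤ ((E : Set (Fin n → ℝ)) ∩ Q.dilate 9).ncard)
    {θ a b D A ε ρ σ : ℝ} {M : ℕ} (hM : 102 / cG < M) (hθ1 : θ < 1) (hθ : 1 / 2 ≤ θ)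
    (hθG : 1 - θ ≤ cG / 24) (hθM : 1 / 2 ≤ θ ^ M) (hD : 64 + 51 / cG ≤ D) (ha : 0 ≤ a)
    (ha1 : a ≤ 1) (hb : 96 * D ≤ b) (hA : 400 ≤ A) (hε : ε ≤ 1 / 128) (hεG : ε ≤ cG / 4)
    {Q : AxisCube n} (hQ : Q ∈ CZ) (hT : IsTight (fun x => (q x).side) E A ε Q)
    {p : Fin n → ℝ} (hp : p ∈ E) (hpQ : dist p Q.center ≤ A * Q.side)
    (hρp : (q p).side ≤ ρ) (hρ : ∀ e ∈ E, dist e Q.center ≤ A * Q.side → 6 * dist p e ≤ ρ)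
    (hρQ : ρ ≤ 7 * ε * Q.side) (hσ : σ = 1 ∨ σ = -1)
    (hσQ : 2 ≤ n ∨ ∀ i, 0 < σ * (Q.center i - p i)) :
    ∃ φ, a * Q.side ≤ φ ∧ φ ≤ b * Q.side ∧
      ReflTransGen (ChainStep (fun x => (q x).side) cG θ a b) (Q.center, φ)
        (p + fun _ => σ * ρ, (q (p + fun _ => σ * ρ)).side) := by
  have hs := Q.side_pos
  have hδ := hCZ.slowlyVarying hcG hq
  have hρ0 : 0 < ρ := (q p).side_pos.trans_le hρp
  have hqc : q Q.center = Q := hCZ.cubeAt_eq hq hQ Q.center_mem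
  have hG0 : 0 < 51 / cG := by positivity
  have hpc : dist p Q.center ≤ 5 * Q.side := by
    obtain ⟨e, he, heQ⟩ := IsCZDecomposition.exists_mem_dist_le hq hE Q.center
    rw [hqc] at heQ
    by_contra hcon
    have h1 := (hT p hp hpQ).2 e he (heQ.trans (by nlinarith))
    obtain ⟨e', he'E, he'⟩ := Set.nonempty_of_ncard_ne_zero
      (s := (E : Set (Fin n → ℝ)) ∩ Q.dilate 9) (by have := hE Q hQ; omega)
    have h2 := dist_center_le_of_mem_dilate (by norm_num) he'
    have h3 := (hT p hp hpQ).2 e' he'E (h2.trans (by nlinarith))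
    have h4 := dist_triangle p e' Q.center
    nlinarith
  -- As δ p is at most side/128, growth from δ p to the side needs distance at least 5cG/2 · side,
  -- which exceeds 7ε · side because ε ≤ cG/4.
  have hlow : ρ ≤ dist p Q.center := by
    have h1 := hδ.le_add hcG p Q.center
    simp only [hqc] at h1
    have h2 := (hT p hp hpQ).1
    simp only at h2
    have h3 : Q.side / 2 ≤ dist p Q.center / (5 * cG) := by nlinarith
    rw [le_div_iff₀ (by positivity)] at h3
    nlinarith
  -- Some e in E is within 5δ of p + w. If e is in the cluster, it is within ρ/6 ≤ ‖w‖/6 of p, so 5δ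
  -- ≥ 5‖w‖/6; otherwise e is hundreds of sides away. The upper bound is linear growth from δ p ≤ ρ
  -- ≤ ‖w‖.
  have hann : ∀ w : Fin n → ℝ, ρ ≤ ‖w‖ → ‖w‖ ≤ 6 * Q.side →
      ‖w‖ / 6 ≤ (q (p + w)).side ∧ (q (p + w)).side ≤ D * ‖w‖ := by
    intro w hw1 hw2
    constructor
    · obtain ⟨e, he, hew⟩ := IsCZDecomposition.exists_mem_dist_le hq hE (p + w)
      have hdw : dist p (p + w) = ‖w‖ := by simp
      by_cases heQ : dist e Q.center ≤ A * Q.side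
      · have h1 := hρ e he heQ
        have h2 := dist_triangle p e (p + w)
        linarith
      · rw [not_le] at heQ
        have h1 := dist_triangle4 e (p + w) p Q.center
        rw [dist_comm (p + w) p, hdw] at h1
        nlinarith
    · have h1 := hδ.le_add hcG p (p + w)
      simp only [dist_self_add_right] at h1
      have h2 : ‖w‖ / (5 * cG) ≤ 51 / cG * ‖w‖ := by
        rw [div_mul_eq_mul_div, div_le_div_iff₀ (by positivity) hcG]
        nlinarith [mul_nonneg hcG.le (norm_nonneg w)]
      nlinarith
  set u := Q.center - p with hu
  have hun : ‖u‖ = dist p Q.center := by rw [hu, ← dist_eq_norm, dist_comm]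
  have hpu : p + u = Q.center := by rw [hu]; abel
  have hu6 : ‖u‖ ≤ 6 * Q.side := by rw [hun]; linarith
  have hstart := hann u (hun ▸ hlow) hu6
  rw [hpu, hqc] at hstart
  refine ⟨8 * D * ‖u‖, ?_, ?_, ?_⟩
  · nlinarith
  · have : 0 ≤ ‖u‖ := norm_nonneg u
    calc 8 * D * ‖u‖ = 48 * D * (‖u‖ / 6) := by ring
      _ ≤ 96 * D * Q.side := by
          have h1 : 48 * D * (‖u‖ / 6) ≤ 48 * D * Q.side := by
            gcongr
            · linarith
            · exact hstart.1
          nlinarith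
      _ ≤ _ := by gcongr
  · have h := exists_chain_annulus (δ := fun x => (q x).side) (p := p) (u := u) (σ := σ) hn hcG hM
      hθ1 hθ hθG hθM (by linarith) ha ha1 hb hρ0 (R := 6 * Q.side) (by nlinarith) hann
      (hun ▸ hlow) hu6 hσ hσQ
    rwa [hpu] at h

end Decomposition

/-! ### Clusters and their targets -/

section Clusters

variable {n : ℕ} {cG : ℝ} {CZ : Set (AxisCube n)} {q : (Fin n → ℝ) → AxisCube n}
  {E : Finset (Fin n → ℝ)} {A ε : ℝ}

open Classical in
/-- The points of `E` within `A` sidelengths of the center of `Q`. -/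
noncomputable def cluster (E : Finset (Fin n → ℝ)) (A : ℝ) (Q : AxisCube n) :
    Finset (Fin n → ℝ) :=
  E.filter fun e => dist e Q.center ≤ A * Q.side

theorem mem_cluster {Q : AxisCube n} {e : Fin n → ℝ} :
    e ∈ cluster E A Q ↔ e ∈ E ∧ dist e Q.center ≤ A * Q.side := by
  simp [cluster]

theorem IsTight.side_le {δ : (Fin n → ℝ) → ℝ} {Q : AxisCube n} (h : IsTight δ E A ε Q)
    {p : Fin n → ℝ} (hp : p ∈ cluster E A Q) : δ p ≤ ε * Q.side :=
  (h p (mem_cluster.1 hp).1 (mem_cluster.1 hp).2).1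

theorem IsTight.dist_le {δ : (Fin n → ℝ) → ℝ} {Q : AxisCube n} (h : IsTight δ E A ε Q)
    {p p' : Fin n → ℝ} (hp : p ∈ cluster E A Q) (hp' : p' ∈ cluster E A Q) :
    dist p p' ≤ ε * Q.side :=
  (h p (mem_cluster.1 hp).1 (mem_cluster.1 hp).2).2 p' (mem_cluster.1 hp').1 (mem_cluster.1 hp').2

theorem exists_mem_cluster_dist_le
    (hE : ∀ Q ∈ CZ, 2 ≤ ((E : Set (Fin n → ℝ)) ∩ Q.dilate 9).ncard) (hA : 400 ≤ A)
    {Q : AxisCube n} (hQ : Q ∈ CZ) :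
    ∃ e ∈ cluster E A Q, dist e Q.center ≤ 9 / 2 * Q.side := by
  obtain ⟨e, heE, he⟩ := Set.nonempty_of_ncard_ne_zero
    (s := (E : Set (Fin n → ℝ)) ∩ Q.dilate 9) (by have := hE Q hQ; omega)
  have h := dist_center_le_of_mem_dilate (by norm_num) he
  exact ⟨e, mem_cluster.2 ⟨heE, h.trans (by nlinarith [Q.side_pos])⟩, h⟩

/-- Tightness pulls the whole cluster of Q to within five sides of its center. Passing to the
neighbouring center costs at most 352.5 + 32.5 cG sides of Q' in total, which is below A. -/
theorem cluster_subset_of_near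
    (hE : ∀ Q ∈ CZ, 2 ≤ ((E : Set (Fin n → ℝ)) ∩ Q.dilate 9).ncard) (hcG : 0 < cG)
    (hA : 400 + 33 * cG ≤ A) (hε : ε ≤ 1 / 128) {δ : (Fin n → ℝ) → ℝ} {Q Q' : AxisCube n}
    (hQ : Q ∈ CZ) (hT : IsTight δ E A ε Q) (hs : Q.side ≤ 64 * Q'.side)
    (h : (Q.dilate (1 + cG) ∩ Q'.dilate (1 + cG)).Nonempty) :
    cluster E A Q ⊆ cluster E A Q' := by
  intro e he
  obtain ⟨e', he', h1⟩ := exists_mem_cluster_dist_le hE (by linarith : 400 ≤ A) hQ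
  have h2 := hT.dist_le he he'
  obtain ⟨w, hw, hw'⟩ := h
  have h3 := dist_center_le_of_mem_dilate (by linarith) hw
  have h4 := dist_center_le_of_mem_dilate (by linarith) hw'
  have h5 := dist_triangle e e' Q.center
  have h6 := dist_triangle e Q.center Q'.center
  have h7 := dist_triangle_left Q.center Q'.center w
  have hs0 := Q.side_pos
  have hs0' := Q'.side_pos
  refine mem_cluster.2 ⟨(mem_cluster.1 he).1, ?_⟩
  have h8 : dist e Q'.center ≤ (5 + (1 + cG) / 2) * Q.side + (1 + cG) / 2 * Q'.side := by
    nlinarith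
  have h9 : (5 + (1 + cG) / 2) * Q.side ≤ (5 + (1 + cG) / 2) * (64 * Q'.side) := by gcongr
  nlinarith

/-- A base point of a finite set. -/
noncomputable def basePoint (X : Finset (Fin n → ℝ)) : Fin n → ℝ :=
  open Classical in if h : X.Nonempty then h.choose else 0

theorem basePoint_mem {X : Finset (Fin n → ℝ)} (h : X.Nonempty) : basePoint X ∈ X := by
  rw [basePoint, dif_pos h]
  exact h.choose_spec

/-- A radius around the base point outside of which the cluster looks like a single point. -/
noncomputable def clusterRadius (δ : (Fin n → ℝ) → ℝ) (X : Finset (Fin n → ℝ)) : ℝ :=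
  6 * Metric.diam (X : Set (Fin n → ℝ)) + δ (basePoint X)

/-- The side of the cluster on which a cube lies, in dimension one; `1` otherwise. -/
noncomputable def clusterSign (X : Finset (Fin n → ℝ)) (Q : AxisCube n) : ℝ :=
  open Classical in if n = 1 ∧ ∃ i, Q.center i < basePoint X i then -1 else 1

/-- The point to which all the tight cubes around a cluster are joined. -/
noncomputable def clusterTarget (δ : (Fin n → ℝ) → ℝ) (X : Finset (Fin n → ℝ)) (σ : ℝ) :
    Fin n → ℝ :=
  basePoint X + fun _ => σ * clusterRadius δ X

/-- Otherwise good geometry would force δ at the base point to be at least side/64, against ε ≤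
1/128. -/
theorem IsCZDecomposition.basePoint_notMem_dilate (hCZ : IsCZDecomposition cG CZ) (hcG : 0 < cG)
    (hq : ∀ x, q x ∈ CZ ∧ x ∈ (q x).toSet)
    (hE : ∀ Q ∈ CZ, 2 ≤ ((E : Set (Fin n → ℝ)) ∩ Q.dilate 9).ncard) (hA : 400 ≤ A)
    (hε : ε ≤ 1 / 128) {Q : AxisCube n} (hQ : Q ∈ CZ)
    (hT : IsTight (fun x => (q x).side) E A ε Q) :
    basePoint (cluster E A Q) ∉ Q.dilate (1 + cG) := by
  intro hmem
  obtain ⟨e, he, -⟩ := exists_mem_cluster_dist_le hE hA hQ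
  have h1 := hT.side_le (basePoint_mem ⟨e, he⟩)
  have h2 := (hCZ.side_comparable hQ (hq (basePoint (cluster E A Q))).1
    ⟨_, Q.dilate_mono (by linarith) hmem,
      toSet_subset_dilate _ (by linarith) (hq (basePoint (cluster E A Q))).2⟩).1
  nlinarith [Q.side_pos]

theorem IsCZDecomposition.clusterSign_spec (hCZ : IsCZDecomposition cG CZ) (hn : 1 ≤ n)
    (hcG : 0 < cG) (hq : ∀ x, q x ∈ CZ ∧ x ∈ (q x).toSet)
    (hE : ∀ Q ∈ CZ, 2 ≤ ((E : Set (Fin n → ℝ)) ∩ Q.dilate 9).ncard) (hA : 400 ≤ A)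
    (hε : ε ≤ 1 / 128) {Q : AxisCube n} (hQ : Q ∈ CZ)
    (hT : IsTight (fun x => (q x).side) E A ε Q) :
    2 ≤ n ∨ ∀ i, 0 < clusterSign (cluster E A Q) Q *
      (Q.center i - basePoint (cluster E A Q) i) := by
  by_cases h2 : 2 ≤ n
  · exact Or.inl h2
  right
  obtain rfl : n = 1 := by omega
  have hne : Q.center 0 ≠ basePoint (cluster E A Q) 0 := by
    intro h
    refine hCZ.basePoint_notMem_dilate hcG hq hE hA hε hQ hT ?_
    have : basePoint (cluster E A Q) = Q.center := by
      ext i; rw [Subsingleton.elim i 0, h]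
    rw [this]
    exact Q.toSet_subset_dilate (by linarith) Q.center_mem
  intro i
  rw [Subsingleton.elim i 0, clusterSign]
  split_ifs with h
  · obtain ⟨-, j, hj⟩ := h
    rw [Subsingleton.elim j 0] at hj
    linarith
  · have h1 : ¬ Q.center 0 < basePoint (cluster E A Q) 0 := fun h' => h ⟨rfl, 0, h'⟩
    have := lt_of_le_of_ne (not_lt.1 h1) hne.symm
    linarith

/-- In dimension one the two dilates are intersecting intervals that both miss the base point, so
their union lies on one side of it. -/
theorem IsCZDecomposition.clusterSign_eq (hCZ : IsCZDecomposition cG CZ)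
    (hcG : 0 < cG) (hq : ∀ x, q x ∈ CZ ∧ x ∈ (q x).toSet)
    (hE : ∀ Q ∈ CZ, 2 ≤ ((E : Set (Fin n → ℝ)) ∩ Q.dilate 9).ncard) (hA : 400 ≤ A)
    (hε : ε ≤ 1 / 128) {Q Q' : AxisCube n} (hQ : Q ∈ CZ) (hQ' : Q' ∈ CZ)
    (hT : IsTight (fun x => (q x).side) E A ε Q) (hT' : IsTight (fun x => (q x).side) E A ε Q')
    (h : (Q.dilate (1 + cG) ∩ Q'.dilate (1 + cG)).Nonempty)
    (hX : cluster E A Q = cluster E A Q') :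
    clusterSign (cluster E A Q) Q = clusterSign (cluster E A Q') Q' := by
  have hp := hCZ.basePoint_notMem_dilate hcG hq hE hA hε hQ hT
  have hp' := hCZ.basePoint_notMem_dilate hcG hq hE hA hε hQ' hT'
  rw [hX] at hp ⊢
  set p := basePoint (cluster E A Q') with hpdef
  unfold clusterSign
  rw [← hpdef]
  congr 1
  rw [eq_iff_iff, and_congr_right_iff]
  rintro rfl
  obtain ⟨w, hw, hw'⟩ := h
  rw [mem_dilate_iff] at hp hp' hw hw'
  have hs := mul_pos (by linarith : 0 < 1 + cG) Q.halfSide_pos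
  have hs' := mul_pos (by linarith : 0 < 1 + cG) Q'.halfSide_pos
  simp only [Fin.exists_fin_one, Fin.forall_fin_one, Fin.isValue, not_and, not_le] at *
  obtain ⟨hw1, hw2⟩ := hw
  obtain ⟨hw1', hw2'⟩ := hw'
  constructor
  · intro hc
    by_contra hc'
    have h1 := hp (by linarith)
    have h2 : p 0 ≤ Q'.center 0 - (1 + cG) * Q'.halfSide := by
      by_contra h3
      linarith [hp' (not_le.1 h3)]
    linarith
  · intro hc
    by_contra hc'
    have h1 := hp' (by linarith)
    have h2 : p 0 ≤ Q.center 0 - (1 + cG) * Q.halfSide := by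
      by_contra h3
      linarith [hp (not_le.1 h3)]
    linarith

/-- Every tight cube is joined by a chain to the target of its cluster. -/
theorem IsCZDecomposition.exists_chain_clusterTarget (hCZ : IsCZDecomposition cG CZ)
    (hn : 1 ≤ n) (hcG : 0 < cG) (hq : ∀ x, q x ∈ CZ ∧ x ∈ (q x).toSet)
    (hE : ∀ Q ∈ CZ, 2 ≤ ((E : Set (Fin n → ℝ)) ∩ Q.dilate 9).ncard)
    {θ a b D : ℝ} {M : ℕ} (hM : 102 / cG < M) (hθ1 : θ < 1) (hθ : 1 / 2 ≤ θ)
    (hθG : 1 - θ ≤ cG / 24) (hθM : 1 / 2 ≤ θ ^ M) (hD : 64 + 51 / cG ≤ D) (ha : 0 ≤ a)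
    (ha1 : a ≤ 1) (hb : 96 * D ≤ b) (hA : 400 ≤ A) (hε0 : 0 ≤ ε) (hε : ε ≤ 1 / 128)
    (hεG : ε ≤ cG / 4) {Q : AxisCube n} (hQ : Q ∈ CZ)
    (hT : IsTight (fun x => (q x).side) E A ε Q) {z : Fin n → ℝ}
    (hz : z = clusterTarget (fun x => (q x).side) (cluster E A Q)
      (clusterSign (cluster E A Q) Q)) :
    ∃ φ, a * Q.side ≤ φ ∧ φ ≤ b * Q.side ∧
      ReflTransGen (ChainStep (fun x => (q x).side) cG θ a b) (Q.center, φ) (z, (q z).side) := by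
  obtain ⟨e₀, he₀, -⟩ := exists_mem_cluster_dist_le hE hA hQ
  have hp := basePoint_mem ⟨e₀, he₀⟩
  have hp' := mem_cluster.1 hp
  have hs := Q.side_pos
  have hσ : clusterSign (cluster E A Q) Q = 1 ∨ clusterSign (cluster E A Q) Q = -1 := by
    unfold clusterSign; split_ifs <;> simp
  have hdiam : Metric.diam (cluster E A Q : Set (Fin n → ℝ)) ≤ ε * Q.side :=
    Metric.diam_le_of_forall_dist_le (by positivity) fun x hx y hy => hT.dist_le hx hy
  subst hz
  refine hCZ.exists_chain_of_isTight hn hcG hq hE hM hθ1 hθ hθG hθM hD ha ha1 hb hA hε hεG hQ hT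
    hp'.1 hp'.2 ?_ ?_ ?_ hσ (hCZ.clusterSign_spec hn hcG hq hE hA hε hQ hT)
  · unfold clusterRadius
    have : 0 ≤ Metric.diam (cluster E A Q : Set (Fin n → ℝ)) := Metric.diam_nonneg
    linarith
  · intro e he heQ
    have h1 := Metric.dist_le_diam_of_mem (cluster E A Q).finite_toSet.isBounded
      (Finset.mem_coe.2 hp) (Finset.mem_coe.2 (mem_cluster.2 ⟨he, heQ⟩))
    have h2 := (q (basePoint (cluster E A Q))).side_pos
    unfold clusterRadius
    linarith
  · have h1 := hT.side_le hp
    unfold clusterRadius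
    linarith

end Clusters

/-! ### Choice of constants and assembly -/

theorem mainTheorem5 (n : ℕ) (hn : 1 ≤ n) (cG : ℝ) (hcG : 0 < cG) :
    ∃ C c : ℝ, 0 < C ∧ 0 < c ∧ c < 1 ∧
      ∀ (CZ : Set (AxisCube n)) (E : Finset (Fin n → ℝ)),
        IsCZDecomposition cG CZ →
        2 ≤ E.card →
        (∀ Q ∈ CZ, 2 ≤ ((E : Set (Fin n → ℝ)) ∩ Q.dilate 9).ncard) →
        ∃ (special : Set (AxisCube n)) (L : AxisCube n → ℕ) (S : AxisCube n → ℕ → AxisCube n),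
          special ⊆ CZ ∧
          (special.Finite ∧ (special.ncard : ℝ) ≤ C * (E.card : ℝ)) ∧
          (∀ Q ∈ CZ,
            1 ≤ L Q ∧
            (∀ l, 1 ≤ l → l ≤ L Q → S Q l ∈ CZ) ∧
            S Q 1 = Q ∧
            IsKeystone CZ (S Q (L Q)) ∧
            (∀ l, 1 ≤ l → l < L Q →
              ((S Q l).dilate (1 + cG) ∩ (S Q (l + 1)).dilate (1 + cG)).Nonempty) ∧
            (∀ l k, 1 ≤ l → l ≤ k → k ≤ L Q →
              (S Q k).side ≤ C * (1 - c) ^ (k - l) * (S Q l).side)) ∧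
          (∀ Q ∈ CZ \ special, ∀ Q' ∈ CZ \ special,
            (Q.dilate (1 + cG) ∩ Q'.dilate (1 + cG)).Nonempty →
              S Q (L Q) = S Q' (L Q')) := by
  obtain ⟨M, hM⟩ := exists_nat_gt (102 / cG)
  have hM0 : (0 : ℝ) < M := lt_trans (by positivity) hM
  have hM1 : (1 : ℝ) ≤ M := by exact_mod_cast Nat.one_le_iff_ne_zero.2 (by rintro rfl; simp at hM0)
  -- The first bound keeps (1 - τ) ^ M ≥ 1/2 by Bernoulli; the second makes radial steps short.
  set τ : ℝ := min (1 / (2 * M)) (cG / 24) with hτ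
  have hτ0 : 0 < τ := lt_min (by positivity) (by positivity)
  have hτ1 : τ ≤ 1 / (2 * M) := min_le_left _ _
  have hτ2 : τ ≤ cG / 24 := min_le_right _ _
  have hτM : M * τ ≤ 1 / 2 := by
    rw [le_div_iff₀ (by positivity)] at hτ1; linarith
  have hτh : τ ≤ 1 / 2 := by nlinarith
  have hθM : 1 / 2 ≤ (1 - τ) ^ M := by
    have := one_add_mul_le_pow (a := -τ) (by linarith) M
    rw [← sub_eq_add_neg] at this
    linarith
  set D : ℝ := 64 + 51 / cG with hD
  have hD64 : 64 < D := by
    have : 0 < 51 / cG := by positivity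
    linarith
  set a : ℝ := 1 / (2 * D) with ha
  have ha0 : 0 < a := by positivity
  have ha1 : a ≤ 1 := by rw [ha, div_le_one (by positivity)]; linarith
  set A : ℝ := 400 + 33 * cG with hA
  set ε : ℝ := min (1 / 128) (cG / 4) with hεdef
  have hε0 : 0 < ε := lt_min (by positivity) (by positivity)
  have hε : ε ≤ 1 / 128 := min_le_left _ _
  have hεG : ε ≤ cG / 4 := min_le_right _ _
  set K : ℕ := (gridBox n (A * (64 + A / (5 * cG)) / ε)).card +
    (gridBox n ((A + ε) * (2 * A + ε) / (ε / 4))).card with hK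
  -- The first summand is b/a from the decay estimate, the second the number of cubes charged to one
  -- point.
  refine ⟨96 * D / a + K, τ, by positivity, hτ0, by linarith, ?_⟩
  intro CZ E hCZ hE2 hE
  obtain ⟨q, hq⟩ := hCZ.exists_cubeAt
  set δ : (Fin n → ℝ) → ℝ := fun x => (q x).side with hδ
  have hE0 : E.Nonempty := Finset.card_pos.1 (by omega)
  obtain ⟨hfin, hcard⟩ := hCZ.finite_and_ncard_not_isTight_le hcG hq hE0 (A := A) (ε := ε)
    (by positivity) hε0
  -- The endpoint is fixed once as a function of the starting point, so equal targets give equal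
  -- keystone cubes.
  choose key hkey hchain using fun x => hCZ.exists_chain_keystone hn hcG hq hE2 hE hM
    (by linarith : 1 - τ ≤ 1) (by linarith) hθM hD.symm.le (by linarith : 1 ≤ 96 * D) x
  set target : AxisCube n → (Fin n → ℝ) := fun Q =>
    clusterTarget δ (cluster E A Q) (clusterSign (cluster E A Q) Q) with htarget
  have hexists : ∀ Q, ∃ (m : ℕ) (f : ℕ → (Fin n → ℝ) × ℝ), Q ∈ CZ → (f 0).1 = Q.center ∧
      IsKeystone CZ (q (f m).1) ∧ (IsTight δ E A ε Q → (f m).1 = key (target Q)) ∧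
      (a * δ (f 0).1 ≤ (f 0).2 ∧ (f 0).2 ≤ 96 * D * δ (f 0).1) ∧
      ∀ i < m, ChainStep δ cG (1 - τ) a (96 * D) (f i) (f (i + 1)) := by
    intro Q
    by_cases hQ : Q ∈ CZ
    · have hqc : q Q.center = Q := hCZ.cubeAt_eq hq hQ Q.center_mem
      have hs := Q.side_pos
      by_cases hT : IsTight δ E A ε Q
      · obtain ⟨φ, h1, h2, h3⟩ := hCZ.exists_chain_clusterTarget hn hcG hq hE hM
          (by linarith : 1 - τ < 1) (by linarith) (by linarith) hθM hD.symm.le ha0.le ha1 le_rfl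
          (by linarith) hε0.le hε hεG hQ hT (z := target Q) rfl
        obtain ⟨m, f, hf0, hfm, hf⟩ := (h3.trans (hchain (target Q))).exists_seq
        refine ⟨m, f, fun _ => ⟨by rw [hf0], by rw [hfm]; exact hkey _, fun _ => by rw [hfm],
          ?_, hf⟩⟩
        rw [hf0]
        simp only [hδ, hqc]
        exact ⟨h1, h2⟩
      · obtain ⟨m, f, hf0, hfm, hf⟩ := (hchain Q.center).exists_seq
        refine ⟨m, f, fun _ => ⟨by rw [hf0], by rw [hfm]; exact hkey _, fun h => absurd h hT,
          ?_, hf⟩⟩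
        rw [hf0]
        simp only [hδ, hqc]
        constructor <;> nlinarith
    · exact ⟨0, fun _ => 0, fun h => absurd h hQ⟩
  choose m f hf using hexists
  -- Chains are indexed from 0 and cube sequences from 1, hence the shift.
  refine ⟨{Q ∈ CZ | ¬ IsTight δ E A ε Q}, fun Q => m Q + 1, fun Q l => q (f Q (l - 1)).1,
    Set.sep_subset _ _, ⟨hfin, ?_⟩, ?_, ?_⟩
  · have h1 : (({Q ∈ CZ | ¬ IsTight δ E A ε Q}.ncard : ℕ) : ℝ) ≤ E.card * K := by
      exact_mod_cast hcard
    have h2 : 0 ≤ 96 * D / a * E.card := by positivity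
    linarith
  · intro Q hQ
    obtain ⟨h0, hm, -, hgood, hstep⟩ := hf Q hQ
    refine ⟨Nat.le_add_left _ _, fun l _ _ => (hq _).1, ?_, by simpa using hm, ?_, ?_⟩
    · simp only [Nat.sub_self, h0]
      exact hCZ.cubeAt_eq hq hQ Q.center_mem
    · intro l hl hlm
      rw [Nat.lt_succ_iff] at hlm
      obtain ⟨i, rfl⟩ := Nat.exists_eq_add_of_le' hl
      simp only [Nat.add_sub_cancel]
      exact ⟨(f Q (i + 1)).1, mem_dilate_of_dist_lt (hq _).2 (hstep i (by omega)).1,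
        toSet_subset_dilate _ (by linarith) (hq _).2⟩
    · intro l k hl hlk hk
      replace hk : k ≤ m Q + 1 := hk
      have h := ChainStep.decay ha0 (by linarith) hstep hgood (l := l - 1) (k := k - 1)
        (by omega) (by omega)
      rw [show k - 1 - (l - 1) = k - l by omega] at h
      refine h.trans ?_
      have hs := (q (f Q (l - 1)).1).side_pos
      have hpow : 0 ≤ (1 - τ) ^ (k - l) := pow_nonneg (by linarith) _
      simp only [hδ]
      gcongr
      linarith [Nat.cast_nonneg (α := ℝ) K]
  · rintro Q ⟨hQ, hQs⟩ Q' ⟨hQ', hQs'⟩ hQQ'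
    have hT : IsTight δ E A ε Q := by_contra fun h => hQs ⟨hQ, h⟩
    have hT' : IsTight δ E A ε Q' := by_contra fun h => hQs' ⟨hQ', h⟩
    obtain ⟨hs1, hs2⟩ := hCZ.side_comparable hQ hQ'
      (hQQ'.mono (Set.inter_subset_inter (Q.dilate_mono (by linarith))
        (Q'.dilate_mono (by linarith))))
    have hX : cluster E A Q = cluster E A Q' := Finset.Subset.antisymm
      (cluster_subset_of_near hE hcG le_rfl hε hQ hT hs1 hQQ')
      (cluster_subset_of_near hE hcG le_rfl hε hQ' hT' hs2 (by rwa [Set.inter_comm]))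
    have hσ := hCZ.clusterSign_eq hcG hq hE (by linarith) hε hQ hQ' hT hT' hQQ' hX
    have htt : target Q = target Q' := by simp only [htarget]; rw [hσ, hX]
    simp only [Nat.add_sub_cancel]
    rw [(hf Q hQ).2.2.1 hT, (hf Q' hQ').2.2.1 hT', htt]
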